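/- Let $F$ be R. Thompson's group: the group, under composition, of all orientation-preserving piecewise linear homeomorphisms of $[0,1]$ with finitely many breakpoints, all of them dyadic rationals, and with all slopes integer powers of $2$. It is finitely generated; fix a finite generating set $S$ of $F$ and equip $F$ with the left-invariant word metric $d(g,h)=|g^{-1}h|_S$. For a metric space $X$ and $\lambda>0$, a $\lambda$-cluster is a set $C\subseteq X$ any two points of which are joined by a finite sequence of points of $C$ whose consecutive members are at distance at most $\lambda$. For $\lambda,D>0$ let $\dim_{(\lambda,D)}(X)$ be the least $n\in\{0,1,2,\dots\}$ such that $X$ can be colored in at most $n+1$ colors so that every monochromatic $\lambda$-cluster has diameter at most $D$ (and $\infty$ if there is no such $n$). For a function $D:(0,\infty)\to(0,\infty)$, the $D$-controlled dimension function of $X$ is $d_{D,X}(\lambda)=\dim_{(\lambda,D(\lambda))}(X)$. Two functions $f,g:(0,\infty)\to[0,\infty]$ have the same growth if there are constants $a,c>0$ such that $f(at)\ge g(t)-c$ and $g(at)\ge f(t)-c$ for all $t>0$. **Theorem.** There is an exponential control function $D(\lambda)=e^{\alpha\lambda}$, with some $\alpha>0$ (depending on $S$), such that the $D$-controlled dimension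 growth of $F$ is exponential, i.e. the function $\lambda\mapsto d_{D,F}(\lambda)=\dim_{(\lambda,e^{\alpha\lambda})}(F)$ has the same growth as $\lambda\mapsto e^{\lambda}$. -/

import Mathlib

open scoped ENNReal

noncomputable section

/-! ### Clusters, controlled dimension, growth -/

namespace DimGrowth

variable {X : Type*}

/-- `C` is an `r`-cluster: any two points of `C` are joined by a chain of points of `C` in which
consecutive points are at distance at most `r`. -/
def IsCluster (d : X → X → ℝ) (r : ℝ) (C : Set X) : Prop :=
  ∀ x ∈ C, ∀ y ∈ C, Relation.ReflTransGen (fun a b => b ∈ C ∧ d a b ≤ r) x y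

/-- `dim_{(r, D)} X ≤ n`: the space can be coloured in `n + 1` colours (a point may have several
colours, a colour may be unused) so that every monochromatic `r`-cluster has diameter at most
`D`. -/
def DimLE (d : X → X → ℝ) (r D : ℝ) (n : ℕ) : Prop :=
  ∃ A : Fin (n + 1) → Set X, (⋃ i, A i) = Set.univ ∧
    ∀ i, ∀ C ⊆ A i, IsCluster d r C → ∀ x ∈ C, ∀ y ∈ C, d x y ≤ D

/-- `dim_{(r, D)} X`, equal to `⊤` if there is no suitable finite colouring. -/
def dim (d : X → X → ℝ) (r D : ℝ) : ℕ∞ :=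
  ⨅ (n : ℕ) (_ : DimLE d r D n), (n : ℕ∞)

/-- The `D`-controlled dimension function `r ↦ dim_{(r, D r)} X`. -/
def controlledDim (d : X → X → ℝ) (D : ℝ → ℝ) (r : ℝ) : ℝ≥0∞ :=
  (dim d r (D r) : ℝ≥0∞)

/-- `f` and `g`, as functions of a positive variable, have the same growth:
`f (a t) ≥ g t - c` and `g (a t) ≥ f t - c` for all `t`, for some constants `a, c > 0`. -/
def SameGrowth (f g : ℝ → ℝ≥0∞) : Prop :=
  ∃ a c : ℝ, 0 < a ∧ 0 < c ∧ ∀ t : ℝ, 0 < t →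
    g t ≤ f (a * t) + ENNReal.ofReal c ∧ f t ≤ g (a * t) + ENNReal.ofReal c

/-- The growth of `f` is that of the exponential function. -/
def HasExponentialGrowth (f : ℝ → ℝ≥0∞) : Prop :=
  SameGrowth f (fun t => ENNReal.ofReal (Real.exp t))

end DimGrowth

/-! ### Word metrics -/

section WordMetric

variable {G : Type*} [Group G]

/-- The least length of a word in the letters `S ∪ S⁻¹` that represents `g`. -/
def wordLength (S : Set G) (g : G) : ℕ :=
  sInf {n | ∃ l : List G, l.length = n ∧ (∀ s ∈ l, s ∈ S ∨ s⁻¹ ∈ S) ∧ l.prod = g}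

/-- The left-invariant word metric of a generating set `S`. -/
def wordDist (S : Set G) (g h : G) : ℝ := (wordLength S (g⁻¹ * h) : ℝ)

end WordMetric

/-! ### Thompson's group `F` -/

namespace Thompson

/-- Dyadic rationals. -/
def IsDyadic (x : ℝ) : Prop := ∃ (m : ℤ) (n : ℕ), x = m / 2 ^ n

/-- `f` is piecewise linear with breakpoints in the finite set `B`, and its slopes are integer
powers of two: on every closed subinterval of `[0, 1]` without points of `B` in its interior, `f` is
affine with slope `2 ^ k` for some integer `k`. -/
def IsPL (B : Finset unitInterval) (f : unitInterval ≃o unitInterval) : Prop :=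
  ∀ u v : unitInterval, u ≤ v → (∀ b ∈ B, ¬ (u < b ∧ b < v)) →
    ∃ k : ℤ, ∀ x : unitInterval, u ≤ x → x ≤ v →
      (f x : ℝ) - f u = (2 : ℝ) ^ k * ((x : ℝ) - u)

/-- `f` is piecewise linear with finitely many breakpoints, all of them dyadic rationals, and with
slopes integer powers of two. -/
def IsDyadicPL (f : unitInterval ≃o unitInterval) : Prop :=
  ∃ B : Finset unitInterval, (∀ b ∈ B, IsDyadic (b : ℝ)) ∧ IsPL B f

theorem IsDyadic.add {x y : ℝ} (hx : IsDyadic x) (hy : IsDyadic y) : IsDyadic (x + y) := by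
  obtain ⟨m, n, rfl⟩ := hx
  obtain ⟨p, q, rfl⟩ := hy
  refine ⟨m * 2 ^ q + p * 2 ^ n, n + q, ?_⟩
  push_cast
  field_simp
  ring

theorem IsDyadic.neg {x : ℝ} (hx : IsDyadic x) : IsDyadic (-x) := by
  obtain ⟨m, n, rfl⟩ := hx
  exact ⟨-m, n, by push_cast; ring⟩

theorem IsDyadic.sub {x y : ℝ} (hx : IsDyadic x) (hy : IsDyadic y) : IsDyadic (x - y) := by
  rw [sub_eq_add_neg]
  exact hx.add hy.neg

theorem IsDyadic.zpow_mul {x : ℝ} (hx : IsDyadic x) (k : ℤ) : IsDyadic ((2 : ℝ) ^ k * x) := by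
  obtain ⟨m, n, rfl⟩ := hx
  obtain ⟨j, rfl | rfl⟩ := k.eq_nat_or_neg
  · exact ⟨2 ^ j * m, n, by push_cast; rw [zpow_natCast]; ring⟩
  · refine ⟨m, j + n, ?_⟩
    rw [zpow_neg, zpow_natCast]
    field_simp
    ring

theorem isDyadic_zero : IsDyadic 0 := ⟨0, 0, by simp⟩

/-- The last breakpoint, or `0`, strictly before a given positive point. -/
theorem exists_prev (B : Finset unitInterval) (z : unitInterval) (hz : 0 < z) :
    ∃ p ∈ insert 0 B, p < z ∧ ∀ b ∈ B, ¬ (p < b ∧ b < z) := by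
  have hne : ((insert 0 B).filter (· < z)).Nonempty := ⟨0, by simp [hz]⟩
  have hm := Finset.max'_mem _ hne
  rw [Finset.mem_filter] at hm
  refine ⟨_, hm.1, hm.2, fun b hb h => ?_⟩
  exact absurd (Finset.le_max' _ b (by simp [hb, h.2])) (not_le.2 h.1)

theorem isDyadic_apply {B : Finset unitInterval} {f : unitInterval ≃o unitInterval}
    (hB : ∀ b ∈ B, IsDyadic (b : ℝ)) (hf : IsPL B f) (z : unitInterval)
    (hz : IsDyadic (z : ℝ)) : IsDyadic (f z : ℝ) := by
  have key : ∀ (n : ℕ) (z : unitInterval), (B.filter (· < z)).card < n → IsDyadic (z : ℝ) →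
      IsDyadic (f z : ℝ) := by
    intro n
    induction n with
    | zero => intro z h; omega
    | succ n ih =>
      intro z hn hz
      have h0 : f 0 = 0 := f.map_bot
      rcases eq_or_lt_of_le (unitInterval.nonneg' (t := z)) with h | h
      · rw [← h, h0]; exact isDyadic_zero
      obtain ⟨p, hp, hpz, hgap⟩ := exists_prev B z h
      obtain ⟨k, hk⟩ := hf p z hpz.le hgap
      have hfp : IsDyadic (f p : ℝ) ∧ IsDyadic (p : ℝ) := by
        rw [Finset.mem_insert] at hp
        rcases hp with rfl | hp
        · rw [h0]; exact ⟨isDyadic_zero, isDyadic_zero⟩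
        · refine ⟨ih p ?_ (hB p hp), hB p hp⟩
          have : (B.filter (· < p)).card < (B.filter (· < z)).card := by
            apply Finset.card_lt_card
            rw [Finset.ssubset_iff_of_subset]
            · exact ⟨p, by simp [hp, hpz], by simp⟩
            · intro b hb
              rw [Finset.mem_filter] at hb ⊢
              exact ⟨hb.1, hb.2.trans hpz⟩
          omega
      have e := hk z hpz.le le_rfl
      have : (f z : ℝ) = f p + (2 : ℝ) ^ k * ((z : ℝ) - p) := by linarith
      rw [this]
      exact hfp.1.add ((hz.sub hfp.2).zpow_mul k)
  exact key _ z (Nat.lt_succ_self _) hz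

theorem isDyadic_of_apply {B : Finset unitInterval} {f : unitInterval ≃o unitInterval}
    (hB : ∀ b ∈ B, IsDyadic (b : ℝ)) (hf : IsPL B f) (z : unitInterval)
    (hz : IsDyadic (f z : ℝ)) : IsDyadic (z : ℝ) := by
  rcases eq_or_lt_of_le (unitInterval.nonneg' (t := z)) with h | h
  · rw [← h]; exact isDyadic_zero
  obtain ⟨p, hp, hpz, hgap⟩ := exists_prev B z h
  obtain ⟨k, hk⟩ := hf p z hpz.le hgap
  have hpd : IsDyadic (p : ℝ) := by
    rw [Finset.mem_insert] at hp
    rcases hp with rfl | hp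
    · exact isDyadic_zero
    · exact hB p hp
  have e := hk z hpz.le le_rfl
  have h2 : (2 : ℝ) ^ (-k) * (2 : ℝ) ^ k = 1 := by
    rw [← zpow_add₀ two_ne_zero]; simp
  have : (z : ℝ) = p + (2 : ℝ) ^ (-k) * ((f z : ℝ) - f p) := by
    rw [e, ← mul_assoc, h2]; ring
  rw [this]
  exact hpd.add ((hz.sub (isDyadic_apply hB hf p hpd)).zpow_mul _)

theorem IsDyadicPL.one : IsDyadicPL 1 :=
  ⟨∅, by simp, fun u v _ _ => ⟨0, fun x _ _ => by simp⟩⟩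

theorem IsDyadicPL.mul {f g : unitInterval ≃o unitInterval} (hf : IsDyadicPL f)
    (hg : IsDyadicPL g) : IsDyadicPL (f * g) := by
  classical
  obtain ⟨B, hB, hf⟩ := hf
  obtain ⟨C, hC, hg⟩ := hg
  refine ⟨C ∪ B.image g.symm, ?_, ?_⟩
  · intro b hb
    rcases Finset.mem_union.1 hb with hb | hb
    · exact hC b hb
    · obtain ⟨c, hc, rfl⟩ := Finset.mem_image.1 hb
      exact isDyadic_of_apply hC hg _ (by simpa using hB c hc)
  · intro u v huv hgap
    obtain ⟨k, hk⟩ := hg u v huv fun b hb => hgap b (Finset.mem_union_left _ hb)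
    obtain ⟨l, hl⟩ := hf (g u) (g v) (g.monotone huv) fun b hb h =>
      hgap (g.symm b) (Finset.mem_union_right _ (Finset.mem_image_of_mem _ hb))
        ⟨g.lt_symm_apply.2 h.1, g.symm_apply_lt.2 h.2⟩
    refine ⟨l + k, fun x hux hxv => ?_⟩
    have e := hl (g x) (g.monotone hux) (g.monotone hxv)
    rw [hk x hux hxv, ← mul_assoc, ← zpow_add₀ two_ne_zero] at e
    exact e

theorem IsDyadicPL.inv {f : unitInterval ≃o unitInterval} (hf : IsDyadicPL f) :
    IsDyadicPL f⁻¹ := by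
  classical
  obtain ⟨B, hB, hf⟩ := hf
  refine ⟨B.image f, ?_, ?_⟩
  · intro b hb
    obtain ⟨c, hc, rfl⟩ := Finset.mem_image.1 hb
    exact isDyadic_apply hB hf c (hB c hc)
  · intro u v huv hgap
    obtain ⟨k, hk⟩ := hf (f.symm u) (f.symm v) (f.symm.monotone huv) fun b hb h =>
      hgap (f b) (Finset.mem_image_of_mem _ hb) ⟨f.symm_apply_lt.1 h.1, f.lt_symm_apply.1 h.2⟩
    refine ⟨-k, fun x hux hxv => ?_⟩
    have e := hk (f.symm x) (f.symm.monotone hux) (f.symm.monotone hxv)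
    rw [f.apply_symm_apply, f.apply_symm_apply] at e
    change ((f.symm x : unitInterval) : ℝ) - (f.symm u : unitInterval) = _
    rw [e, ← mul_assoc, ← zpow_add₀ two_ne_zero]
    simp

/-- R. Thompson's group `F`: the group, under composition, of the orientation-preserving
piecewise linear homeomorphisms of `[0, 1]` with finitely many breakpoints, all at dyadic rationals,
and with all slopes integer powers of two. (Order automorphisms of `[0, 1]` are the same as
orientation-preserving homeomorphisms.) -/
def F : Subgroup (unitInterval ≃o unitInterval) where
  carrier := {f | IsDyadicPL f}
  mul_mem' := IsDyadicPL.mul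
  one_mem' := IsDyadicPL.one
  inv_mem' := IsDyadicPL.inv

end Thompson

end

/-! ### Colourings and clusters -/

/-! Upper bound: a ball of radius `r` in a finitely generated group has at most `q ^ ⌊r⌋₊` elements,
so greedy colouring with one more colour separates any two distinct points at distance at most `r`.
Monochromatic clusters are then single points, whatever the control function (`dimLE_wordDist`).

Lower bound: `F` contains exponentially many commuting elements of linearly growing word length. Two
elements of `F` contract `[1/4, 3/4]` to its left and right halves. Words of length `k` in them
carry `[1/4, 3/4]` to `2 ^ k` intervals with disjoint interiors, and conjugating a fixed bump by
these words gives `2 ^ k` commuting elements of length `O(k)`. Products of subsets of them form a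
Hamming cube of dimension `2 ^ k`. Flipping two coordinates costs `O(k)` in the word metric
(`wordLength_cubeMap_le`). Conversely, elements that differ in `m` coordinates have a quotient with
at least `m` breakpoints (`card_symmDiff_le`), while breakpoints grow at most linearly with word
length (`exists_breakpoints_le`), so Hamming distance is at most a constant times word distance.

A double count (`card_mul_le_of_clusters`) shows that an `N`-dimensional cube needs about `N / R`
colours if its monochromatic `2`-clusters have diameter at most `R`. With `k` proportional to `r`
and `R` of the order of the square root of `2 ^ k`, both `R` and the number of colours are
exponential in `r`. -/

namespace DimGrowth

/-- Greedy colouring of a graph of bounded degree. -/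
theorem exists_proper_colouring {X : Type*} (adj : X → X → Prop)
    (hsymm : ∀ x y, adj x y → adj y x) (N : ℕ) (hfin : ∀ x, {y | adj x y}.Finite)
    (hcard : ∀ x, {y | adj x y}.ncard ≤ N) :
    ∃ c : X → Fin (N + 1), ∀ x y, adj x y → x ≠ y → c x ≠ c y := by
  classical
  -- Recursion along a well-order: take a colour not used by the earlier neighbours. The default `0`
  -- never occurs, since at most `N` of the `N + 1` colours are blocked.
  let step : (x : X) → ((y : X) → WellOrderingRel y x → Fin (N + 1)) → Fin (N + 1) :=
    fun x ih => if h : ∃ k : Fin (N + 1), ∀ y (hy : WellOrderingRel y x), adj x y → ih y hy ≠ k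
      then h.choose else 0
  have wf : WellFounded (WellOrderingRel : X → X → Prop) := WellOrderingRel.isWellOrder.wf
  let c : X → Fin (N + 1) := wf.fix step
  have hc : ∀ x y, WellOrderingRel y x → adj x y → c y ≠ c x := by
    intro x
    have hex : ∃ k : Fin (N + 1), ∀ y (_ : WellOrderingRel y x), adj x y → c y ≠ k := by
      by_contra! hcon
      have hsub : (Set.univ : Set (Fin (N + 1))) ⊆ c '' {y | adj x y} := fun k _ => by
        obtain ⟨y, _, hy, rfl⟩ := hcon k
        exact ⟨y, hy, rfl⟩
      have h1 := Set.ncard_le_ncard hsub ((hfin x).image c)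
      have h2 := Set.ncard_image_le (f := c) (hfin x)
      have h3 := hcard x
      rw [Set.ncard_univ, Nat.card_eq_fintype_card, Fintype.card_fin] at h1
      omega
    have hx : c x = hex.choose := by
      change wf.fix step x = _
      rw [WellFounded.fix_eq]
      exact dif_pos hex
    intro y hy hxy
    rw [hx]
    exact hex.choose_spec y hy hxy
  refine ⟨c, fun x y hxy hne => ?_⟩
  rcases trichotomous_of (WellOrderingRel : X → X → Prop) x y with h | h | h
  · exact hc y x h (hsymm x y hxy)
  · exact absurd h hne
  · exact (hc x y h hxy).symm

theorem DimLE.of_proper_colouring {X : Type*} {d : X → X → ℝ} {r D : ℝ} {n : ℕ}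
    (hd : ∀ x, d x x ≤ D) (c : X → Fin (n + 1))
    (hc : ∀ x y, d x y ≤ r → x ≠ y → c x ≠ c y) : DimLE d r D n := by
  refine ⟨fun i => c ⁻¹' {i}, by ext x; simp, fun i C hCi hC x hx y hy => ?_⟩
  have key : ∀ z, Relation.ReflTransGen (fun a b => b ∈ C ∧ d a b ≤ r) x z → x = z := by
    intro z hz
    induction hz with
    | refl => rfl
    | tail _ hbc ih =>
      subst ih
      by_contra hne
      exact hc _ _ hbc.2 hne ((hCi hx).trans (hCi hbc.1).symm)
  rw [← key y (hC x hx y hy)]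
  exact hd x

/-- Pull the colouring back: chains map to chains, so images of clusters are clusters. This carries
a colouring of `F` to the Hamming cube. -/
theorem DimLE.comap {X Y : Type*} {dX : X → X → ℝ} {dY : Y → Y → ℝ} {r r' D D' : ℝ} {n : ℕ}
    (φ : X → Y) (h₁ : ∀ x y, dX x y ≤ r → dY (φ x) (φ y) ≤ r')
    (h₂ : ∀ x y, dY (φ x) (φ y) ≤ D' → dX x y ≤ D) (h : DimLE dY r' D' n) : DimLE dX r D n := by
  obtain ⟨A, hA, hC⟩ := h
  refine ⟨fun i => φ ⁻¹' A i, ?_, fun i C hCi hCC x hx y hy => ?_⟩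
  · rw [← Set.preimage_iUnion, hA, Set.preimage_univ]
  · refine h₂ x y (hC i (φ '' C) (Set.image_subset_iff.2 hCi) ?_ _ ⟨x, hx, rfl⟩ _ ⟨y, hy, rfl⟩)
    rintro _ ⟨u, hu, rfl⟩ _ ⟨v, hv, rfl⟩
    exact (hCC u hu v hv).lift φ fun a b hab => ⟨⟨b, hab.1, rfl⟩, h₁ a b hab.2⟩

/-! ### The Hamming cube -/

/-- The Hamming distance of two finite sets. -/
def hamming {ι : Type*} [DecidableEq ι] (x y : Finset ι) : ℝ := ((symmDiff x y).card : ℝ)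

/-- In a Hamming cube, a set all of whose `2`-clusters are contained in balls of radius `r` has
density at most `(r + 1) / (n - r)`. -/
theorem card_mul_le_of_clusters {ι : Type*} [Fintype ι] [DecidableEq ι] (r : ℕ)
    (A : Finset (Finset ι)) (o : Finset ι → Finset ι)
    (ho : ∀ x ∈ A, (symmDiff x (o x)).card ≤ r)
    (hoo : ∀ x ∈ A, ∀ y ∈ A, hamming x y ≤ 2 → o x = o y) :
    A.card * (Fintype.card ι - r) ≤ 2 ^ Fintype.card ι * (r + 1) := by
  -- Double count the single flips out of `A` that move away from the centre `o x`. Each `x ∈ A` has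
  -- at least `n - r` of them.
  let R : Finset ι → Finset ι → Prop := fun x y => ∃ i ∉ symmDiff x (o x), y = symmDiff x {i}
  have hinj : ∀ x : Finset ι, Function.Injective fun i : ι => symmDiff x {i} := fun x i j hij =>
    Finset.singleton_injective (symmDiff_right_injective x hij)
  have h := Finset.card_mul_le_card_mul (s := A) (t := (Finset.univ : Finset (Finset ι))) R
    (m := Fintype.card ι - r) (n := r + 1) ?_ ?_
  · rwa [Finset.card_univ, Fintype.card_finset] at h
  · intro x hx
    have hsub : ((symmDiff x (o x))ᶜ).image (fun i => symmDiff x {i}) ⊆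
        Finset.bipartiteAbove R Finset.univ x := by
      intro y hy
      obtain ⟨i, hi, rfl⟩ := Finset.mem_image.1 hy
      rw [Finset.mem_bipartiteAbove]
      exact ⟨Finset.mem_univ _, i, Finset.mem_compl.1 hi, rfl⟩
    have := Finset.card_le_card hsub
    rw [Finset.card_image_of_injective _ (hinj x), Finset.card_compl] at this
    have := ho x hx
    omega
  · intro y _
    rcases (Finset.bipartiteBelow R A y).eq_empty_or_nonempty with he | ⟨x₀, hx₀⟩
    · simp [he]
    rw [Finset.mem_bipartiteBelow] at hx₀
    obtain ⟨hx₀, i₀, hi₀, rfl⟩ := hx₀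
    -- All sources of a given `y` are within two flips of each other, so they share one centre. Each
    -- is obtained from `y` by undoing a flip at a coordinate where `y` differs from that centre,
    -- and there are at most `r + 1` such coordinates.
    have hsub : Finset.bipartiteBelow R A (symmDiff x₀ {i₀}) ⊆
        (insert i₀ (symmDiff x₀ (o x₀))).image (fun i => symmDiff (symmDiff x₀ {i₀}) {i}) := by
      intro x hx
      rw [Finset.mem_bipartiteBelow] at hx
      obtain ⟨hx, i, hi, hxi⟩ := hx
      have hxx : x = symmDiff (symmDiff x₀ {i₀}) {i} := by
        rw [hxi, symmDiff_assoc, symmDiff_self, symmDiff_bot]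
      have hox : o x₀ = o x := by
        refine hoo _ hx₀ _ hx ?_
        have : symmDiff x₀ x = symmDiff {i₀} {i} := by
          rw [hxx, symmDiff_assoc, ← symmDiff_assoc x₀ x₀, symmDiff_self, bot_symmDiff]
        unfold hamming
        rw [this]
        have h2 : (symmDiff ({i₀} : Finset ι) {i}).card ≤ 2 := by
          calc _ ≤ ({i₀} ∪ {i} : Finset ι).card :=
                Finset.card_le_card fun j => by
                  simp only [Finset.mem_symmDiff, Finset.mem_union]; tauto
            _ ≤ _ := by simpa using Finset.card_union_le ({i₀} : Finset ι) {i}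
        exact_mod_cast h2
      refine Finset.mem_image.2 ⟨i, ?_, hxx.symm⟩
      rw [← hox, hxx] at hi
      simp only [Finset.mem_symmDiff, Finset.mem_insert, Finset.mem_singleton] at hi ⊢
      tauto
    calc _ ≤ _ := Finset.card_le_card hsub
      _ ≤ (insert i₀ (symmDiff x₀ (o x₀))).card := Finset.card_image_le
      _ ≤ _ := (Finset.card_insert_le _ _).trans (Nat.succ_le_succ (ho x₀ hx₀))

theorem hamming_comm {ι : Type*} [DecidableEq ι] (x y : Finset ι) :
    hamming x y = hamming y x := by
  unfold hamming; rw [symmDiff_comm]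

/-- The Hamming cube of dimension `n` needs about `n / r` colours for its monochromatic
`2`-clusters to have diameter at most `r`. -/
theorem card_le_of_dimLE_hamming {ι : Type*} [Fintype ι] [DecidableEq ι] {r m : ℕ}
    (h : DimLE (hamming (ι := ι)) 2 r m) : Fintype.card ι ≤ r + (m + 1) * (r + 1) := by
  classical
  obtain ⟨A, hA, hC⟩ := h
  have hAi : ∀ i, (Finset.univ.filter (· ∈ A i)).card * (Fintype.card ι - r) ≤
      2 ^ Fintype.card ι * (r + 1) := by
    intro i
    let R : A i → A i → Prop := fun a b => hamming a.1 b.1 ≤ 2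
    -- The centre is a chosen representative of the `2`-cluster component of `x` in the colour
    -- class; the value outside `A i` is irrelevant.
    let o : Finset ι → Finset ι := fun x =>
      if hx : x ∈ A i then ((Quot.mk R ⟨x, hx⟩).out : A i).1 else x
    have hR : Equivalence (Relation.ReflTransGen R) :=
      ⟨fun _ => .refl, fun h => by
        have : Std.Symm R := ⟨fun a b hab => (hamming_comm _ _).trans_le hab⟩
        exact Relation.ReflTransGen.stdSymm.symm _ _ h, fun h k => h.trans k⟩
    refine card_mul_le_of_clusters r _ o (fun x hx => ?_) (fun x hx y hy hxy => ?_)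
    · replace hx : x ∈ A i := by simpa using hx
      have ho : o x = ((Quot.mk R ⟨x, hx⟩).out : A i).1 := dif_pos hx
      have hconn : Relation.ReflTransGen R ⟨x, hx⟩ (Quot.mk R ⟨x, hx⟩).out := by
        have h1 : Quot.mk R (Quot.mk R ⟨x, hx⟩).out = Quot.mk R ⟨x, hx⟩ := Quot.out_eq _
        have h2 := Quot.eqvGen_exact h1
        refine hR.symm ?_
        exact (hR.eqvGen_iff).1 (h2.mono fun _ _ h => .single h)
      rw [ho]
      -- The whole component of `x` is a cluster containing both `x` and `o x`, so its diameter
      -- bounds their distance.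
      let C : Set (Finset ι) := {y | ∃ hy : y ∈ A i, Relation.ReflTransGen R ⟨x, hx⟩ ⟨y, hy⟩}
      have hcl : IsCluster hamming 2 C := by
        rintro u ⟨hu, hxu⟩ v ⟨hv, hxv⟩
        have huv := hR.trans (hR.symm hxu) hxv
        have key : ∀ w : A i, Relation.ReflTransGen R ⟨u, hu⟩ w →
            Relation.ReflTransGen (fun a b => b ∈ C ∧ hamming a b ≤ 2) u w.1 := by
          intro w hw
          induction hw with
          | refl => exact .refl
          | @tail b c hab hbc ih =>
            exact ih.tail ⟨⟨c.2, (hxu.trans hab).tail hbc⟩, hbc⟩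
        exact key ⟨v, hv⟩ huv
      have := hC i C (fun y hy => hy.1) hcl x ⟨hx, .refl⟩ _ ⟨Subtype.prop _, hconn⟩
      unfold hamming at this
      exact_mod_cast this
    · replace hx : x ∈ A i := by simpa using hx
      replace hy : y ∈ A i := by simpa using hy
      have e : Quot.mk R ⟨x, hx⟩ = Quot.mk R ⟨y, hy⟩ := Quot.sound hxy
      simp only [o, dif_pos hx, dif_pos hy, e]
  have hcov : 2 ^ Fintype.card ι ≤ ∑ i, (Finset.univ.filter (· ∈ A i)).card := by
    have : (Finset.univ : Finset (Finset ι)) ⊆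
        Finset.univ.biUnion fun i => Finset.univ.filter (· ∈ A i) := by
      intro x _
      have hx : x ∈ ⋃ i, A i := hA ▸ Set.mem_univ x
      obtain ⟨i, hi⟩ := Set.mem_iUnion.1 hx
      exact Finset.mem_biUnion.2 ⟨i, Finset.mem_univ _, by simpa using hi⟩
    have h1 := (Finset.card_le_card this).trans Finset.card_biUnion_le
    rwa [Finset.card_univ, Fintype.card_finset] at h1
  have hsum : 2 ^ Fintype.card ι * (Fintype.card ι - r) ≤
      2 ^ Fintype.card ι * ((m + 1) * (r + 1)) :=
    calc _ ≤ (∑ i, (Finset.univ.filter (· ∈ A i)).card) * (Fintype.card ι - r) :=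
          Nat.mul_le_mul_right _ hcov
      _ ≤ ∑ _i : Fin (m + 1), 2 ^ Fintype.card ι * (r + 1) := by
          rw [Finset.sum_mul]; exact Finset.sum_le_sum fun i _ => hAi i
      _ = _ := by simp; ring
  have := Nat.le_of_mul_le_mul_left hsum (by positivity)
  omega

end DimGrowth

/-! ### Word metrics -/

section WordMetric

open scoped Pointwise

variable {G : Type*} [Group G] {S : Set G}

theorem wordLength_le {l : List G} (hl : ∀ s ∈ l, s ∈ S ∨ s⁻¹ ∈ S) :
    wordLength S l.prod ≤ l.length :=
  Nat.sInf_le ⟨l, rfl, hl, rfl⟩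

theorem exists_word (hS : Subgroup.closure S = ⊤) (g : G) :
    ∃ l : List G, l.length = wordLength S g ∧ (∀ s ∈ l, s ∈ S ∨ s⁻¹ ∈ S) ∧ l.prod = g := by
  refine Nat.sInf_mem (s := {n | ∃ l : List G, l.length = n ∧ (∀ s ∈ l, s ∈ S ∨ s⁻¹ ∈ S) ∧
    l.prod = g}) ?_
  have hg : g ∈ Submonoid.closure (S ∪ S⁻¹) := by
    rw [← Subgroup.closure_toSubmonoid, hS]; exact Subgroup.mem_top g
  obtain ⟨l, hl, rfl⟩ := Submonoid.exists_list_of_mem_closure hg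
  exact ⟨_, l, rfl, hl, rfl⟩

theorem wordLength_one : wordLength S 1 = 0 :=
  Nat.le_zero.1 (wordLength_le (l := []) (by simp))

theorem wordLength_mul_le (hS : Subgroup.closure S = ⊤) (g h : G) :
    wordLength S (g * h) ≤ wordLength S g + wordLength S h := by
  obtain ⟨l, hl, hlS, rfl⟩ := exists_word hS g
  obtain ⟨m, hm, hmS, rfl⟩ := exists_word hS h
  rw [← hl, ← hm, ← List.prod_append, ← List.length_append]
  refine wordLength_le fun s hs => ?_
  rcases List.mem_append.1 hs with hs | hs
  exacts [hlS s hs, hmS s hs]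

theorem wordLength_inv_le (hS : Subgroup.closure S = ⊤) (g : G) :
    wordLength S g⁻¹ ≤ wordLength S g := by
  obtain ⟨l, hl, hlS, rfl⟩ := exists_word hS g
  rw [← hl, List.prod_inv_reverse]
  refine (wordLength_le fun s hs => ?_).trans (by simp)
  simp only [List.mem_reverse, List.mem_map] at hs
  obtain ⟨t, ht, rfl⟩ := hs
  rw [inv_inv]
  exact (hlS t ht).symm

/-- A finitely generated group has at most exponential dimension growth. -/
theorem dimLE_wordDist (hS : S.Finite) (hgen : Subgroup.closure S = ⊤) :
    ∃ q : ℕ, 0 < q ∧ ∀ r D : ℝ, 0 ≤ D →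
      DimGrowth.DimLE (wordDist S) r D (q ^ ⌊r⌋₊) := by
  classical
  -- Symmetric, so that adjacency is symmetric; it contains `1`, so that its powers increase and
  -- contain all shorter words.
  let T : Finset G := insert 1 (hS.toFinset ∪ hS.toFinset⁻¹)
  have hTinv : T⁻¹ = T := by
    ext x; simp [T, or_comm]
  have hT1 : (1 : G) ∈ T := Finset.mem_insert_self _ _
  refine ⟨T.card, Finset.card_pos.2 ⟨1, hT1⟩, fun r D hD => ?_⟩
  have hball : ∀ g : G, (wordLength S g : ℝ) ≤ r → g ∈ T ^ ⌊r⌋₊ := by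
    intro g hg
    obtain ⟨l, hl, hlS, rfl⟩ := exists_word hgen g
    have hlen : l.length ≤ ⌊r⌋₊ := Nat.le_floor (by rw [hl]; exact hg)
    have hmem : ∀ l : List G, (∀ s ∈ l, s ∈ S ∨ s⁻¹ ∈ S) → l.prod ∈ T ^ l.length := by
      intro l
      induction l with
      | nil => intro _; simp
      | cons s l ih =>
        intro h
        rw [List.prod_cons, List.length_cons, pow_succ']
        refine Finset.mul_mem_mul ?_ (ih fun t ht => h t (List.mem_cons_of_mem _ ht))
        have := h s List.mem_cons_self
        simp [T, this]
    exact Finset.pow_subset_pow_right hT1 hlen (hmem l hlS)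
  have heq : ∀ x : G, {y | x⁻¹ * y ∈ T ^ ⌊r⌋₊} = (fun z => x * z) '' (T ^ ⌊r⌋₊ : Finset G) := by
    intro x
    ext y
    constructor
    · intro hy
      exact ⟨x⁻¹ * y, hy, by simp⟩
    · rintro ⟨z, hz, rfl⟩
      change x⁻¹ * (x * z) ∈ T ^ ⌊r⌋₊
      rw [inv_mul_cancel_left]
      exact hz
  obtain ⟨c, hc⟩ := DimGrowth.exists_proper_colouring (fun x y : G => x⁻¹ * y ∈ T ^ ⌊r⌋₊)
    (fun x y h => by
      have h' := Finset.inv_mem_inv h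
      rw [← inv_pow, hTinv] at h'
      simpa using h')
    (T.card ^ ⌊r⌋₊) (fun x => by rw [heq]; exact (Finset.finite_toSet _).image _)
    (fun x => by
      rw [heq]
      refine (Set.ncard_image_le (Finset.finite_toSet _)).trans ?_
      rw [Set.ncard_coe_finset]
      exact Finset.card_pow_le)
  refine DimGrowth.DimLE.of_proper_colouring (fun x => ?_) c fun x y hxy hne =>
    hc x y (hball _ hxy) hne
  simpa [wordDist, wordLength_one] using hD

end WordMetric

noncomputable section

/-! ### Breakpoints -/

namespace Thompson

/-- Breakpoints of the composite come from those of `g` and the `g`-preimages of those of `f`, so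
their number is subadditive. -/
theorem IsPL.mul {B C : Finset unitInterval} {f g : unitInterval ≃o unitInterval}
    (hf : IsPL B f) (hg : IsPL C g) :
    ∃ E : Finset unitInterval, E.card ≤ B.card + C.card ∧ IsPL E (f * g) := by
  classical
  refine ⟨C ∪ B.image g.symm, ?_, fun u v huv hgap => ?_⟩
  · have h1 := Finset.card_union_le C (B.image g.symm)
    have h2 : (B.image g.symm).card ≤ B.card := Finset.card_image_le
    omega
  · obtain ⟨k, hk⟩ := hg u v huv fun b hb => hgap b (Finset.mem_union_left _ hb)
    obtain ⟨l, hl⟩ := hf (g u) (g v) (g.monotone huv) fun b hb h =>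
      hgap (g.symm b) (Finset.mem_union_right _ (Finset.mem_image_of_mem _ hb))
        ⟨g.lt_symm_apply.2 h.1, g.symm_apply_lt.2 h.2⟩
    refine ⟨l + k, fun x hux hxv => ?_⟩
    have e := hl (g x) (g.monotone hux) (g.monotone hxv)
    rw [hk x hux hxv, ← mul_assoc, ← zpow_add₀ two_ne_zero] at e
    exact e

/-- The number of breakpoints is bounded by a multiple of the word length. -/
theorem exists_breakpoints_le {S : Set F} (hS : S.Finite) (hgen : Subgroup.closure S = ⊤) :
    ∃ K : ℕ, ∀ f : F, ∃ B : Finset unitInterval,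
      B.card ≤ K * wordLength S f ∧ IsPL B (f : unitInterval ≃o unitInterval) := by
  choose b _ hbPL using fun f : F => f.2
  obtain ⟨K, hK⟩ := ((hS.union hS.inv).image fun f => (b f).card).bddAbove
  refine ⟨K, fun f => ?_⟩
  obtain ⟨l, hl, hlS, rfl⟩ := exists_word hgen f
  rw [← hl]
  clear hl
  induction l with
  | nil => exact ⟨∅, by simp, fun u v _ _ => ⟨0, fun x _ _ => by simp⟩⟩
  | cons s l ih =>
    obtain ⟨B, hB, hBPL⟩ := ih fun t ht => hlS t (List.mem_cons_of_mem _ ht)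
    obtain ⟨E, hE, hEPL⟩ := (hbPL s).mul hBPL
    refine ⟨E, ?_, ?_⟩
    · have hs : (b s).card ≤ K := hK ⟨s, hlS s List.mem_cons_self, rfl⟩
      rw [List.length_cons, mul_add]
      omega
    · rw [List.prod_cons]
      exact hEPL

/-! ### Two contractions of the interval `[1/4, 3/4]` -/

/-- The order automorphism of `[0, 1]` induced by an order automorphism of the line. -/
def orderIsoOfReal (f g : ℝ → ℝ) (hf : StrictMono f) (hfg : ∀ x, f (g x) = x) (h0 : f 0 = 0)
    (h1 : f 1 = 1) : unitInterval ≃o unitInterval :=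
  StrictMono.orderIsoOfRightInverse
    (fun x => ⟨f x, h0 ▸ hf.monotone x.2.1, h1 ▸ hf.monotone x.2.2⟩)
    (fun _ _ h => hf h)
    (fun x => ⟨g x, hf.le_iff_le.1 (by rw [h0, hfg]; exact x.2.1),
      hf.le_iff_le.1 (by rw [h1, hfg]; exact x.2.2)⟩)
    (fun x => Subtype.ext (hfg x))

/-- Maps `[1/4, 3/4]` to `[1/4, 1/2]`. -/
def contractLeftFun (x : ℝ) : ℝ :=
  if x ≤ 1 / 4 then x else if x ≤ 3 / 4 then x / 2 + 1 / 8 else 2 * x - 1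

/-- Maps `[1/4, 3/4]` to `[1/2, 3/4]`. -/
def contractRightFun (x : ℝ) : ℝ :=
  if x ≤ 1 / 4 then 2 * x else if x ≤ 3 / 4 then x / 2 + 3 / 8 else x

/-- `contractLeftFun` on `[0, 1]`. -/
def contractLeftIso : unitInterval ≃o unitInterval :=
  orderIsoOfReal contractLeftFun
    (fun y => if y ≤ 1 / 4 then y else if y ≤ 1 / 2 then 2 * y - 1 / 4 else (y + 1) / 2)
    (fun x y h => by unfold contractLeftFun; split_ifs <;> linarith)
    (fun x => by unfold contractLeftFun; split_ifs <;> linarith)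
    (by norm_num [contractLeftFun]) (by norm_num [contractLeftFun])

/-- `contractRightFun` on `[0, 1]`. -/
def contractRightIso : unitInterval ≃o unitInterval :=
  orderIsoOfReal contractRightFun
    (fun y => if y ≤ 1 / 2 then y / 2 else if y ≤ 3 / 4 then 2 * y - 3 / 4 else y)
    (fun x y h => by unfold contractRightFun; split_ifs <;> linarith)
    (fun x => by unfold contractRightFun; split_ifs <;> linarith)
    (by norm_num [contractRightFun]) (by norm_num [contractRightFun])

/-- The point `1/4`. -/
def quarter : unitInterval := ⟨1 / 4, by norm_num, by norm_num⟩

/-- The point `1/2`. -/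
def half : unitInterval := ⟨1 / 2, by norm_num, by norm_num⟩

/-- The point `3/4`. -/
def threeQuarters : unitInterval := ⟨3 / 4, by norm_num, by norm_num⟩

theorem isDyadic_of_mem_quarters (b : unitInterval)
    (hb : b ∈ ({quarter, threeQuarters} : Finset unitInterval)) : IsDyadic (b : ℝ) := by
  rw [Finset.mem_insert, Finset.mem_singleton] at hb
  rcases hb with rfl | rfl
  · exact ⟨1, 2, by norm_num [quarter]⟩
  · exact ⟨3, 2, by norm_num [threeQuarters]⟩

theorem quarters_gap {u v : unitInterval}
    (h : ∀ b ∈ ({quarter, threeQuarters} : Finset unitInterval), ¬ (u < b ∧ b < v)) :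
    (v : ℝ) ≤ 1 / 4 ∨ (1 / 4 ≤ (u : ℝ) ∧ (v : ℝ) ≤ 3 / 4) ∨ 3 / 4 ≤ (u : ℝ) := by
  have h1 := h quarter (by simp)
  have h2 := h threeQuarters (by simp)
  rw [← Subtype.coe_lt_coe, ← Subtype.coe_lt_coe] at h1 h2
  simp only [quarter, threeQuarters, not_and_or, not_lt] at h1 h2
  grind

theorem contractLeftIso_apply (x : unitInterval) :
    (contractLeftIso x : ℝ) = contractLeftFun x := rfl

theorem contractRightIso_apply (x : unitInterval) :
    (contractRightIso x : ℝ) = contractRightFun x := rfl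

theorem isDyadicPL_contractLeftIso : IsDyadicPL contractLeftIso := by
  refine ⟨{quarter, threeQuarters}, isDyadic_of_mem_quarters, fun u v huv hgap => ?_⟩
  rcases quarters_gap hgap with h | ⟨h, h'⟩ | h
  · refine ⟨0, fun x hu hv => ?_⟩
    rw [← Subtype.coe_le_coe] at hu hv
    simp only [contractLeftIso_apply, contractLeftFun]
    split_ifs <;> norm_num <;> linarith
  · refine ⟨-1, fun x hu hv => ?_⟩
    rw [← Subtype.coe_le_coe] at hu hv
    simp only [contractLeftIso_apply, contractLeftFun, zpow_neg_one]
    split_ifs <;> linarith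
  · refine ⟨1, fun x hu hv => ?_⟩
    rw [← Subtype.coe_le_coe] at hu hv
    simp only [contractLeftIso_apply, contractLeftFun, zpow_one]
    split_ifs <;> linarith

theorem isDyadicPL_contractRightIso : IsDyadicPL contractRightIso := by
  refine ⟨{quarter, threeQuarters}, isDyadic_of_mem_quarters, fun u v huv hgap => ?_⟩
  rcases quarters_gap hgap with h | ⟨h, h'⟩ | h
  · refine ⟨1, fun x hu hv => ?_⟩
    rw [← Subtype.coe_le_coe] at hu hv
    simp only [contractRightIso_apply, contractRightFun, zpow_one]
    split_ifs <;> linarith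
  · refine ⟨-1, fun x hu hv => ?_⟩
    rw [← Subtype.coe_le_coe] at hu hv
    simp only [contractRightIso_apply, contractRightFun, zpow_neg_one]
    split_ifs <;> linarith
  · refine ⟨0, fun x hu hv => ?_⟩
    rw [← Subtype.coe_le_coe] at hu hv
    simp only [contractRightIso_apply, contractRightFun]
    split_ifs <;> norm_num <;> linarith

/-- The element of `F` that maps `[1/4, 3/4]` linearly to its right half (`true`) or to its left
half (`false`). -/
def contract : Bool → F
  | true => ⟨contractRightIso, isDyadicPL_contractRightIso⟩
  | false => ⟨contractLeftIso, isDyadicPL_contractLeftIso⟩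

theorem coe_contract_true_smul (x : unitInterval) :
    ((contract true • x : unitInterval) : ℝ) = contractRightFun x := rfl

theorem coe_contract_false_smul (x : unitInterval) :
    ((contract false • x : unitInterval) : ℝ) = contractLeftFun x := rfl

theorem smul_le_smul_iff (f : F) {x y : unitInterval} : f • x ≤ f • y ↔ x ≤ y :=
  (f : unitInterval ≃o unitInterval).le_iff_le

theorem smul_lt_smul_iff (f : F) {x y : unitInterval} : f • x < f • y ↔ x < y :=
  (f : unitInterval ≃o unitInterval).lt_iff_lt

open Set

theorem contract_smul_mem (c : Bool) {x : unitInterval} (hx : x ∈ Icc quarter threeQuarters) :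
    contract c • x ∈ Icc quarter threeQuarters := by
  simp only [mem_Icc, ← Subtype.coe_le_coe, quarter, threeQuarters] at hx ⊢
  cases c
  · rw [coe_contract_false_smul, contractLeftFun]; split_ifs <;> constructor <;> linarith
  · rw [coe_contract_true_smul, contractRightFun]; split_ifs <;> constructor <;> linarith

/-- The two half intervals meet only at `1/2`, which an interior point cannot reach. Allowing `y` to
be an endpoint later shows that each bump fixes the closed intervals of the others. -/
theorem contract_smul_ne {c c' : Bool} (hc : c ≠ c') {x y : unitInterval}
    (hx : x ∈ Ioo quarter threeQuarters) (hy : y ∈ Icc quarter threeQuarters) :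
    contract c • x ≠ contract c' • y := by
  intro h
  replace h := congrArg Subtype.val h
  simp only [mem_Icc, mem_Ioo, ← Subtype.coe_le_coe, ← Subtype.coe_lt_coe, quarter,
    threeQuarters] at hx hy
  cases c <;> cases c'
  · exact hc rfl
  · rw [coe_contract_false_smul, contractLeftFun, coe_contract_true_smul, contractRightFun] at h
    split_ifs at h <;> linarith
  · rw [coe_contract_false_smul, contractLeftFun, coe_contract_true_smul, contractRightFun] at h
    split_ifs at h <;> linarith
  · exact hc rfl

/-! ### Words in the contractions, and bumps supported in their images -/

/-- The composition of the contractions along a word. -/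
def contractWord (w : List Bool) : F := (w.map contract).prod

theorem contractWord_cons (c : Bool) (w : List Bool) :
    contractWord (c :: w) = contract c * contractWord w := by
  simp [contractWord]

theorem contractWord_smul_mem (w : List Bool) {x : unitInterval}
    (hx : x ∈ Icc quarter threeQuarters) : contractWord w • x ∈ Icc quarter threeQuarters := by
  induction w with
  | nil => simpa [contractWord] using hx
  | cons c w ih => rw [contractWord_cons, mul_smul]; exact contract_smul_mem c ih

theorem contractWord_smul_mem_Ioo (w : List Bool) {x : unitInterval}
    (hx : x ∈ Ioo quarter threeQuarters) : contractWord w • x ∈ Ioo quarter threeQuarters := by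
  have hle : quarter ≤ threeQuarters := (hx.1.trans hx.2).le
  exact ⟨(contractWord_smul_mem w ⟨le_rfl, hle⟩).1.trans_lt ((smul_lt_smul_iff _).2 hx.1),
    ((smul_lt_smul_iff _).2 hx.2).trans_le (contractWord_smul_mem w ⟨hle, le_rfl⟩).2⟩

/-- The first letter acts last, so it selects the half. Equal first letters cancel, and different
ones separate the images. -/
theorem contractWord_smul_ne : ∀ {w w' : List Bool}, w.length = w'.length → w ≠ w' →
    ∀ {x y : unitInterval}, x ∈ Ioo quarter threeQuarters → y ∈ Icc quarter threeQuarters →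
      contractWord w • x ≠ contractWord w' • y
  | [], [], _, hne, _, _, _, _ => absurd rfl hne
  | [], _ :: _, hl, _, _, _, _, _ => by simp at hl
  | _ :: _, [], hl, _, _, _, _, _ => by simp at hl
  | c :: w, c' :: w', hl, hne, x, y, hx, hy => by
    rw [contractWord_cons, contractWord_cons, mul_smul, mul_smul]
    by_cases hc : c = c'
    · subst hc
      intro h
      exact contractWord_smul_ne (by simpa using hl) (by rintro rfl; exact hne rfl) hx hy
        (smul_left_cancel _ h)
    · exact contract_smul_ne hc (contractWord_smul_mem_Ioo w hx) (contractWord_smul_mem w' hy)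

/-- A nontrivial element of `F` supported in `[1/4, 3/4]`. -/
def bump : F := contract true * contract false * (contract true)⁻¹ * (contract false)⁻¹

/-- To the left of `1/4`, `contract false` is the identity and `(contract true)⁻¹` moves points
further left, so the commutator cancels. To the right of `3/4` the roles are exchanged. -/
theorem bump_smul_of_notMem {x : unitInterval} (hx : x ∉ Ioo quarter threeQuarters) :
    bump • x = x := by
  have ht : ∀ y : unitInterval, threeQuarters ≤ y → contract true • y = y := fun y hy => by
    apply Subtype.ext
    rw [← Subtype.coe_le_coe] at hy
    simp only [threeQuarters] at hy
    rw [coe_contract_true_smul, contractRightFun]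
    split_ifs <;> linarith
  have hf : ∀ y : unitInterval, y ≤ quarter → contract false • y = y := fun y hy => by
    apply Subtype.ext
    rw [← Subtype.coe_le_coe] at hy
    simp only [quarter] at hy
    rw [coe_contract_false_smul, contractLeftFun, if_pos hy]
  have ht' : ∀ y : unitInterval, y ≤ contract true • y := fun y => by
    rw [← Subtype.coe_le_coe, coe_contract_true_smul, contractRightFun]
    have := y.2.1
    split_ifs <;> linarith
  have hf' : ∀ y : unitInterval, contract false • y ≤ y := fun y => by
    rw [← Subtype.coe_le_coe, coe_contract_false_smul, contractLeftFun]
    have := y.2.2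
    split_ifs <;> linarith
  rw [mem_Ioo, not_and_or, not_lt, not_lt] at hx
  simp only [bump, mul_smul]
  rcases hx with hx | hx
  · rw [inv_smul_eq_iff.2 (hf x hx).symm, hf _ (le_trans ?_ hx), smul_inv_smul]
    rw [← smul_le_smul_iff (contract true), smul_inv_smul]
    exact ht' x
  · have hle : x ≤ (contract false)⁻¹ • x := by
      rw [← smul_le_smul_iff (contract false), smul_inv_smul]
      exact hf' x
    rw [inv_smul_eq_iff.2 (ht _ (hx.trans hle)).symm, smul_inv_smul, ht x hx]

theorem bump_smul_half : bump • half ≠ half := by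
  have h1 : (contract false)⁻¹ • half = threeQuarters := by
    rw [inv_smul_eq_iff]
    apply Subtype.ext
    rw [coe_contract_false_smul]
    norm_num [contractLeftFun, half, threeQuarters]
  have h2 : (contract true)⁻¹ • threeQuarters = threeQuarters := by
    rw [inv_smul_eq_iff]
    apply Subtype.ext
    rw [coe_contract_true_smul]
    norm_num [contractRightFun, threeQuarters]
  have h3 : contract false • threeQuarters = half := by rw [← h1, smul_inv_smul]
  simp only [bump, mul_smul, h1, h2, h3]
  intro h
  have := congrArg Subtype.val h
  rw [coe_contract_true_smul] at this
  norm_num [contractRightFun, half] at this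

/-- The conjugate of `bump` by a word in the contractions. -/
def bumpAt (w : List Bool) : F := contractWord w * bump * (contractWord w)⁻¹

theorem bumpAt_smul (w : List Bool) (y : unitInterval) :
    bumpAt w • contractWord w • y = contractWord w • bump • y := by
  simp only [bumpAt, mul_smul, inv_smul_smul]

theorem bumpAt_smul_eq_self {w : List Bool} {x : unitInterval}
    (hx : ∀ y ∈ Ioo quarter threeQuarters, contractWord w • y ≠ x) : bumpAt w • x = x := by
  have h := bumpAt_smul w ((contractWord w)⁻¹ • x)
  rw [smul_inv_smul, bump_smul_of_notMem, smul_inv_smul] at h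
  · exact h
  · intro hmem
    exact hx _ hmem (smul_inv_smul _ _)

theorem bumpAt_smul_of_ne {w w' : List Bool} (hl : w.length = w'.length) (hne : w ≠ w')
    {y : unitInterval} (hy : y ∈ Icc quarter threeQuarters) :
    bumpAt w • contractWord w' • y = contractWord w' • y :=
  bumpAt_smul_eq_self fun _ hz => contractWord_smul_ne hl hne hz hy

/-- The supports are disjoint, and `F` acts faithfully on `[0, 1]`. -/
theorem commute_bumpAt {w w' : List Bool} (hl : w.length = w'.length) (hne : w ≠ w') :
    Commute (bumpAt w) (bumpAt w') := by
  have hd : Equiv.Perm.Disjoint (MulAction.toPerm (bumpAt w) : Equiv.Perm unitInterval)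
      (MulAction.toPerm (bumpAt w')) := by
    intro x
    by_cases hx : ∀ y ∈ Ioo quarter threeQuarters, contractWord w • y ≠ x
    · exact Or.inl (bumpAt_smul_eq_self hx)
    · push Not at hx
      obtain ⟨y, hy, rfl⟩ := hx
      exact Or.inr (bumpAt_smul_of_ne hl.symm hne.symm (Ioo_subset_Icc_self hy))
  refine eq_of_smul_eq_smul (α := unitInterval) fun x => ?_
  rw [mul_smul, mul_smul]
  exact congrArg (fun σ : Equiv.Perm unitInterval => σ x) hd.commute.eq

/-! ### The Hamming cube in `F` -/

theorem pairwise_commute_bumpAt (k : ℕ) : Pairwise fun w w' : List.Vector Bool k =>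
    ∀ m n : Multiplicative ℤ, Commute (zpowersHom F (bumpAt w.toList) m)
      (zpowersHom F (bumpAt w'.toList) n) := by
  intro w w' hne m n
  simp only [zpowersHom_apply]
  exact (commute_bumpAt (w.toList_length.trans w'.toList_length.symm)
    fun h => hne (List.Vector.toList_injective h)).zpow_zpow _ _

/-- Products of powers of the bumps at the words of length `k`. -/
def bumpHom (k : ℕ) : (List.Vector Bool k → Multiplicative ℤ) →* F :=
  MonoidHom.noncommPiCoprod (fun w => zpowersHom F (bumpAt w.toList)) (pairwise_commute_bumpAt k)

theorem bumpHom_mulSingle {k : ℕ} (w : List.Vector Bool k) (m : Multiplicative ℤ) :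
    bumpHom k (Pi.mulSingle w m) = bumpAt w.toList ^ m.toAdd := by
  rw [bumpHom, MonoidHom.noncommPiCoprod_mulSingle, zpowersHom_apply]

theorem bumpHom_smul_eq_self {k : ℕ} {z : List.Vector Bool k → Multiplicative ℤ}
    {x : unitInterval} (h : ∀ w, z w = 1 ∨ bumpAt w.toList • x = x) : bumpHom k z • x = x := by
  change bumpHom k z ∈ MulAction.stabilizer F x
  rw [bumpHom, MonoidHom.noncommPiCoprod_apply]
  refine Subgroup.noncommProd_mem _ _ fun w _ => ?_
  rw [zpowersHom_apply]
  rcases h w with h | h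
  · rw [h]; exact one_mem _
  · exact zpow_mem (MulAction.mem_stabilizer_iff.2 h) _

/-- Split off the factor at `w`; all the others fix the closed interval of `w` pointwise. -/
theorem bumpHom_smul {k : ℕ} (z : List.Vector Bool k → Multiplicative ℤ)
    (w : List.Vector Bool k) {y : unitInterval} (hy : y ∈ Icc quarter threeQuarters) :
    bumpHom k z • contractWord w.toList • y = bumpAt w.toList ^ (z w).toAdd • contractWord w.toList • y := by
  classical
  have hz : z = Pi.mulSingle w (z w) * Function.update z w 1 := by
    ext v
    by_cases hv : v = w
    · subst hv; simp
    · simp [hv]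
  rw [hz, map_mul, mul_smul, bumpHom_mulSingle, bumpHom_smul_eq_self (z := Function.update z w 1)]
  · simp
  · intro v
    by_cases hv : v = w
    · subst hv; simp
    · exact Or.inr (bumpAt_smul_of_ne (v.toList_length.trans w.toList_length.symm) (fun h => hv (List.Vector.toList_injective h)) hy)

/-- A product of bumps has a breakpoint in the support of each of its factors. -/
theorem exists_breakpoint {k : ℕ} {z : List.Vector Bool k → Multiplicative ℤ}
    {w : List.Vector Bool k} (hw : (z w).toAdd = 1 ∨ (z w).toAdd = -1) {B : Finset unitInterval}
    (hB : IsPL B (bumpHom k z : unitInterval ≃o unitInterval)) :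
    ∃ b ∈ B, ∃ y ∈ Ioo quarter threeQuarters, contractWord w.toList • y = b := by
  have hqh : quarter < half := by
    rw [← Subtype.coe_lt_coe]; norm_num [quarter, half]
  have hht : half < threeQuarters := by
    rw [← Subtype.coe_lt_coe]; norm_num [threeQuarters, half]
  have hqt := hqh.trans hht
  by_contra! hcon
  have hend : ∀ y ∈ Icc quarter threeQuarters, y ∉ Ioo quarter threeQuarters →
      bumpHom k z • contractWord w.toList • y = contractWord w.toList • y := by
    intro y hy hy'
    have h1 : bumpAt w.toList • contractWord w.toList • y = contractWord w.toList • y := by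
      rw [bumpAt_smul, bump_smul_of_notMem hy']
    rw [bumpHom_smul z w hy]
    exact zpow_mem (MulAction.mem_stabilizer_iff.2 h1 :
      bumpAt w.toList ∈ MulAction.stabilizer F (contractWord w.toList • y)) _
  have hu := hend quarter ⟨le_rfl, hqt.le⟩ (by simp)
  have hv := hend threeQuarters ⟨hqt.le, le_rfl⟩ (by simp)
  -- Without a breakpoint inside, the map is affine on the interval of `w`. Its endpoints are fixed,
  -- so the slope is `1` and the image of the midpoint is fixed too, contrary to `bump_smul_half`.
  obtain ⟨m, hm⟩ := hB (contractWord w.toList • quarter) (contractWord w.toList • threeQuarters)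
    ((smul_le_smul_iff _).2 hqt.le) fun b hb hbb => hcon b hb ((contractWord w.toList)⁻¹ • b)
      ⟨by rw [← smul_lt_smul_iff (contractWord w.toList), smul_inv_smul]; exact hbb.1,
        by rw [← smul_lt_smul_iff (contractWord w.toList), smul_inv_smul]; exact hbb.2⟩
      (smul_inv_smul _ _)
  have hlt : ((contractWord w.toList • quarter : unitInterval) : ℝ) <
      (contractWord w.toList • threeQuarters : unitInterval) :=
    Subtype.coe_lt_coe.2 ((smul_lt_smul_iff _).2 hqt)
  have e1 := hm _ ((smul_le_smul_iff _).2 hqt.le) le_rfl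
  have e2 := hm (contractWord w.toList • half) ((smul_le_smul_iff _).2 hqh.le)
    ((smul_le_smul_iff _).2 hht.le)
  change ((bumpHom k z • contractWord w.toList • threeQuarters : unitInterval) : ℝ) -
    (bumpHom k z • contractWord w.toList • quarter : unitInterval) = _ at e1
  change ((bumpHom k z • contractWord w.toList • half : unitInterval) : ℝ) -
    (bumpHom k z • contractWord w.toList • quarter : unitInterval) = _ at e2
  rw [hu] at e1 e2
  rw [hv] at e1
  have hslope : (2 : ℝ) ^ m = 1 :=
    mul_right_cancel₀ (sub_ne_zero.2 hlt.ne') (by rw [← e1, one_mul])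
  rw [hslope, one_mul] at e2
  have hfix : bumpHom k z • contractWord w.toList • half = contractWord w.toList • half :=
    Subtype.ext (by linarith)
  rw [bumpHom_smul z w ⟨hqh.le, hht.le⟩] at hfix
  have hfix' : bumpAt w.toList • contractWord w.toList • half = contractWord w.toList • half := by
    rcases hw with h | h
    · rwa [h, zpow_one] at hfix
    · rw [h, zpow_neg_one, inv_smul_eq_iff] at hfix
      exact hfix.symm
  rw [bumpAt_smul] at hfix'
  exact bump_smul_half (smul_left_cancel _ hfix')

/-- The indicator function of a set of words, as exponents. -/
def exponents {k : ℕ} (x : Finset (List.Vector Bool k)) (w : List.Vector Bool k) :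
    Multiplicative ℤ :=
  Multiplicative.ofAdd (if w ∈ x then 1 else 0)

/-- The product of the bumps at a set of words of length `k`. -/
def cubeMap (k : ℕ) (x : Finset (List.Vector Bool k)) : F := bumpHom k (exponents x)

theorem inv_cubeMap_mul {k : ℕ} (x y : Finset (List.Vector Bool k)) :
    (cubeMap k x)⁻¹ * cubeMap k y = bumpHom k ((exponents x)⁻¹ * exponents y) := by
  rw [cubeMap, cubeMap, map_mul, map_inv]

theorem exponents_of_mem {k : ℕ} {x y : Finset (List.Vector Bool k)} {w : List.Vector Bool k}
    (hw : w ∈ symmDiff x y) : (((exponents x)⁻¹ * exponents y) w).toAdd = 1 ∨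
      (((exponents x)⁻¹ * exponents y) w).toAdd = -1 := by
  rw [Finset.mem_symmDiff] at hw
  rcases hw with ⟨h1, h2⟩ | ⟨h1, h2⟩
  · right; simp [exponents, h1, h2]
  · left; simp [exponents, h1, h2]

/-- The breakpoints of `x⁻¹ y` are at least as many as the words at which `x` and `y` differ. -/
theorem card_symmDiff_le {k : ℕ} (x y : Finset (List.Vector Bool k)) {B : Finset unitInterval}
    (hB : IsPL B (((cubeMap k x)⁻¹ * cubeMap k y : F) : unitInterval ≃o unitInterval)) :
    (symmDiff x y).card ≤ B.card := by
  rw [inv_cubeMap_mul] at hB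
  choose! b hbB t ht htb using fun w (hw : w ∈ symmDiff x y) =>
    exists_breakpoint (exponents_of_mem hw) hB
  -- Breakpoints for different words are distinct because they lie in disjoint open intervals.
  refine Finset.card_le_card_of_injOn b hbB fun w hw w' hw' h => ?_
  by_contra hne
  refine contractWord_smul_ne (w.toList_length.trans w'.toList_length.symm) (fun h => hne (List.Vector.toList_injective h)) (ht w hw)
    (Ioo_subset_Icc_self (ht w' hw')) ?_
  rw [htb w hw, htb w' hw', h]

/-! ### Word lengths of bumps and of edges of the cube -/

section WordLength

variable {S : Set F}

theorem wordLength_contractWord_le (hgen : Subgroup.closure S = ⊤) {L : ℕ} (hL : ∀ c, wordLength S (contract c) ≤ L)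
    (w : List Bool) : wordLength S (contractWord w) ≤ w.length * L := by
  induction w with
  | nil => simp [contractWord, wordLength_one]
  | cons c w ih =>
    rw [contractWord_cons, List.length_cons, add_mul, one_mul]
    have := wordLength_mul_le hgen (contract c) (contractWord w)
    have := hL c
    omega

theorem exists_wordLength_bumpAt_le (hgen : Subgroup.closure S = ⊤) :
    ∃ M : ℕ, 0 < M ∧ ∀ w : List Bool, 0 < w.length → wordLength S (bumpAt w) ≤ M * w.length := by
  let L := max (wordLength S (contract true)) (wordLength S (contract false))
  have hL : ∀ c, wordLength S (contract c) ≤ L := by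
    intro c
    cases c
    exacts [le_max_right _ _, le_max_left _ _]
  -- Conjugation costs `2 * L` per letter; the length of `bump` is absorbed because `w` is nonempty,
  -- and `+ 1` makes `M` positive.
  refine ⟨2 * L + wordLength S bump + 1, by omega, fun w hw => ?_⟩
  have h1 := wordLength_contractWord_le hgen hL w
  have h2 := wordLength_inv_le hgen (contractWord w)
  have h3 := wordLength_mul_le hgen (contractWord w * bump) (contractWord w)⁻¹
  have h4 := wordLength_mul_le hgen (contractWord w) bump
  have h5 : wordLength S bump ≤ wordLength S bump * w.length := Nat.le_mul_of_pos_right _ hw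
  unfold bumpAt
  nlinarith

/-- Flip the coordinates one at a time; each flip multiplies by a bump or its inverse. -/
theorem wordLength_cubeMap_le (hgen : Subgroup.closure S = ⊤) {k L : ℕ}
    (hL : ∀ w : List.Vector Bool k, wordLength S (bumpAt w.toList) ≤ L)
    (x y : Finset (List.Vector Bool k)) :
    wordLength S ((cubeMap k x)⁻¹ * cubeMap k y) ≤ (symmDiff x y).card * L := by
  have single : ∀ (x : Finset (List.Vector Bool k)) (w : List.Vector Bool k),
      wordLength S ((cubeMap k x)⁻¹ * cubeMap k (symmDiff x {w})) ≤ L := by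
    intro x w
    have e : (exponents x)⁻¹ * exponents (symmDiff x {w}) =
        Pi.mulSingle w (((exponents x)⁻¹ * exponents (symmDiff x {w})) w) := by
      ext v
      by_cases hv : v = w
      · subst hv; simp
      · simp [hv, exponents, Finset.mem_symmDiff]
    have hw : w ∈ symmDiff x (symmDiff x {w}) := by
      rw [symmDiff_symmDiff_cancel_left]; exact Finset.mem_singleton_self w
    rw [inv_cubeMap_mul, e, bumpHom_mulSingle]
    rcases exponents_of_mem hw with h | h
    · rw [h, zpow_one]; exact hL w
    · rw [h, zpow_neg_one]; exact (wordLength_inv_le hgen _).trans (hL w)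
  have key : ∀ s : Finset (List.Vector Bool k),
      wordLength S ((cubeMap k x)⁻¹ * cubeMap k (symmDiff x s)) ≤ s.card * L := by
    intro s
    induction s using Finset.induction_on with
    | empty =>
      have : symmDiff x (∅ : Finset (List.Vector Bool k)) = x := symmDiff_bot x
      simp [this, wordLength_one]
    | insert w s hw ih =>
      have e : symmDiff x (insert w s) = symmDiff (symmDiff x s) {w} := by
        ext v
        simp only [Finset.mem_symmDiff, Finset.mem_insert, Finset.mem_singleton]
        by_cases hv : v = w
        · subst hv; simp [hw]
        · simp [hv]
      rw [e, Finset.card_insert_of_notMem hw, add_mul, one_mul]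
      have h1 := wordLength_mul_le hgen ((cubeMap k x)⁻¹ * cubeMap k (symmDiff x s))
        ((cubeMap k (symmDiff x s))⁻¹ * cubeMap k (symmDiff (symmDiff x s) {w}))
      rw [mul_assoc, mul_inv_cancel_left] at h1
      have h2 := single (symmDiff x s) w
      omega
  simpa [symmDiff_symmDiff_cancel_left] using key (symmDiff x y)

end WordLength

end Thompson

end

/-! ### Dimension growth -/

namespace Thompson

/-- Lower bound for the controlled dimension of `F`. -/
theorem exists_lower_bound {S : Set F} (hS : S.Finite) (hgen : Subgroup.closure S = ⊤) :
    ∃ α K : ℝ, 0 < α ∧ 0 < K ∧ ∀ (r : ℝ) (n : ℕ), 0 < r →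
      DimGrowth.DimLE (wordDist S) r (Real.exp (α * r)) n →
        Real.exp (α * r) ≤ 4 * K * (n + 2) := by
  obtain ⟨M, hM, hMw⟩ := exists_wordLength_bumpAt_le hgen
  obtain ⟨K₀, hK₀⟩ := exists_breakpoints_le hS hgen
  have hMR : (0 : ℝ) < M := by exact_mod_cast hM
  -- Chosen so that `exp (β * r) = 2 ^ (r / (2 * M))`, the cube dimension up to rounding. The
  -- control exponent `β / 2` gives its square root `E`, which leaves a factor `E` for the colours.
  set β : ℝ := Real.log 2 / (2 * M) with hβ
  have hβ0 : 0 < β := by positivity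
  refine ⟨β / 2, K₀ + 1, by positivity, by positivity, fun r n hr h => ?_⟩
  set E : ℝ := Real.exp (β / 2 * r) with hE
  have hE1 : 1 ≤ E := Real.one_le_exp (by positivity)
  -- The largest `k` for which two flips, of length at most `M * k` each, stay within distance `r`.
  set k : ℕ := ⌊r / (2 * M)⌋₊ with hk
  set R : ℕ := ⌊K₀ * E⌋₊ with hR
  have hcard : 2 ^ k ≤ (n + 2) * (R + 1) := by
    rcases Nat.eq_zero_or_pos k with hk0 | hk0
    · rw [hk0, pow_zero]; exact Nat.mul_pos (by omega) (by omega)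
    have hcube : DimGrowth.DimLE (DimGrowth.hamming (ι := List.Vector Bool k)) 2 R n := by
      refine h.comap (cubeMap k) (fun x y hxy => ?_) (fun x y hxy => ?_)
      · have hc : (symmDiff x y).card ≤ 2 := by
          unfold DimGrowth.hamming at hxy; exact_mod_cast hxy
        have h1 := wordLength_cubeMap_le hgen (k := k) (L := M * k)
          (fun w => by simpa [w.toList_length] using hMw w.toList (by rw [w.toList_length]; exact hk0)) x y
        have h2 : wordLength S ((cubeMap k x)⁻¹ * cubeMap k y) ≤ 2 * (M * k) :=
          h1.trans (Nat.mul_le_mul_right _ hc)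
        have h3 : (k : ℝ) ≤ r / (2 * M) := Nat.floor_le (by positivity)
        rw [le_div_iff₀ (by positivity)] at h3
        have h4 : (wordLength S ((cubeMap k x)⁻¹ * cubeMap k y) : ℝ) ≤ 2 * (M * k) := by
          exact_mod_cast h2
        unfold wordDist
        linarith
      · obtain ⟨B, hB, hBPL⟩ := hK₀ ((cubeMap k x)⁻¹ * cubeMap k y)
        have h1 := (card_symmDiff_le x y hBPL).trans hB
        unfold wordDist at hxy
        unfold DimGrowth.hamming
        rw [Nat.cast_le]
        refine Nat.le_floor ?_
        calc ((symmDiff x y).card : ℝ)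
            ≤ K₀ * (wordLength S ((cubeMap k x)⁻¹ * cubeMap k y) : ℝ) := by exact_mod_cast h1
          _ ≤ K₀ * E := by gcongr
    have h1 := DimGrowth.card_le_of_dimLE_hamming hcube
    rw [card_vector, Fintype.card_bool] at h1
    nlinarith
  have hRle : (R : ℝ) ≤ K₀ * E := Nat.floor_le (by positivity)
  -- The factor `2` pays for rounding `r / (2 * M)` down to `k`.
  have hpow : E * E ≤ 2 * 2 ^ k := by
    have h1 : r / (2 * M) < k + 1 := Nat.lt_floor_add_one _
    have h2 : (2 : ℝ) * 2 ^ k = Real.exp (Real.log 2 * (k + 1)) := by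
      rw [← Real.rpow_def_of_pos two_pos, ← Nat.cast_succ, Real.rpow_natCast, pow_succ']
    rw [h2, hE, ← Real.exp_add, Real.exp_le_exp]
    calc β / 2 * r + β / 2 * r = Real.log 2 * (r / (2 * M)) := by rw [hβ]; ring
      _ ≤ _ := mul_le_mul_of_nonneg_left h1.le (Real.log_nonneg one_le_two)
  have hcardR : (2 : ℝ) ^ k ≤ (n + 2) * (R + 1) := by exact_mod_cast hcard
  have h5 : (n + 2 : ℝ) * (R + 1) ≤ (n + 2) * ((K₀ + 1) * E) := by
    gcongr; linarith
  have h6 : E * E ≤ (2 * (K₀ + 1) * (n + 2)) * E := by linarith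
  have h7 := le_of_mul_le_mul_right h6 (by linarith)
  have h8 : (0 : ℝ) ≤ (K₀ + 1) * (n + 2) := by positivity
  linarith

end Thompson

theorem DimGrowth.dim_eq_top_or_exists {X : Type*} (d : X → X → ℝ) (r D : ℝ) :
    dim d r D = ⊤ ∨ ∃ n : ℕ, DimLE d r D n ∧ dim d r D = n := by
  classical
  by_cases h : ∃ n, DimLE d r D n
  · refine Or.inr ⟨Nat.find h, Nat.find_spec h, le_antisymm (iInf₂_le _ (Nat.find_spec h)) ?_⟩
    exact le_iInf₂ fun n hn => by exact_mod_cast Nat.find_min' h hn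
  · push Not at h
    left
    simp [dim, h]

/-- For the word metric of any finite generating set `S` of Thompson's group `F` there is an
exponential control function `D r = exp (α r)`, `α > 0`, such that the `D`-controlled dimension
growth of `F` is exponential. -/
theorem theorem5 (S : Set Thompson.F) (hS : S.Finite) (hgen : Subgroup.closure S = ⊤) :
    ∃ α : ℝ, 0 < α ∧
      DimGrowth.HasExponentialGrowth
        (DimGrowth.controlledDim (wordDist S) (fun r => Real.exp (α * r))) := by
  obtain ⟨α, K, hα, hK, hlow⟩ := Thompson.exists_lower_bound hS hgen
  obtain ⟨q, hq, hup⟩ := dimLE_wordDist hS hgen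
  -- `2 / α` serves the lower bound and `log q` the upper one.
  refine ⟨α, hα, max (2 / α) (Real.log q), K + 2, lt_max_of_lt_left (by positivity),
    by positivity, fun t ht => ⟨?_, ?_⟩⟩
  · set a := max (2 / α) (Real.log q)
    have ha : 2 / α ≤ a := le_max_left _ _
    have ha0 : 0 < a := lt_of_lt_of_le (by positivity) ha
    unfold DimGrowth.controlledDim
    rcases DimGrowth.dim_eq_top_or_exists (wordDist S) (a * t) (Real.exp (α * (a * t))) with
      h | ⟨n, hn, h⟩
    · rw [h]; simp
    rw [h, ENat.toENNReal_coe, ← ENNReal.ofReal_natCast,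
      ← ENNReal.ofReal_add (by positivity) (by positivity)]
    refine ENNReal.ofReal_le_ofReal ?_
    have h1 := hlow (a * t) n (by positivity) hn
    have h2 : Real.exp t * Real.exp t ≤ Real.exp (α * (a * t)) := by
      rw [← Real.exp_add, Real.exp_le_exp]
      rw [div_le_iff₀ hα] at ha
      nlinarith
    -- Equivalence of growth allows no multiplicative constant outside. Rescaling by `2 / α` yields
    -- `exp t` squared, and `4 * K * exp t ≤ (exp t) ^ 2 + 4 * K ^ 2` turns the factor `4 * K` into
    -- the additive constant `K + 2`.
    have h3 : (0 : ℝ) ≤ (Real.exp t - 2 * K) ^ 2 := sq_nonneg _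
    have h4 : 4 * K * Real.exp t ≤ 4 * K * (n + (K + 2)) := by nlinarith
    exact le_of_mul_le_mul_left h4 (by positivity)
  · refine le_add_right ?_
    unfold DimGrowth.controlledDim
    have h1 : DimGrowth.dim (wordDist S) t (Real.exp (α * t)) ≤ (q ^ ⌊t⌋₊ : ℕ) :=
      iInf₂_le _ (hup t _ (Real.exp_pos _).le)
    have h2 : ((DimGrowth.dim (wordDist S) t (Real.exp (α * t)) : ℕ∞) : ℝ≥0∞) ≤
        ((q ^ ⌊t⌋₊ : ℕ) : ℝ≥0∞) := by
      rw [← ENat.toENNReal_coe]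
      exact ENat.toENNReal_le.2 h1
    refine h2.trans ?_
    rw [← ENNReal.ofReal_natCast]
    refine ENNReal.ofReal_le_ofReal ?_
    have hq0 : (0 : ℝ) < q := by exact_mod_cast hq
    have hq1 : (1 : ℝ) ≤ q := by exact_mod_cast hq
    calc ((q ^ ⌊t⌋₊ : ℕ) : ℝ) = Real.exp (Real.log q * ⌊t⌋₊) := by
          rw [← Real.rpow_def_of_pos hq0, Real.rpow_natCast, Nat.cast_pow]
      _ ≤ _ := Real.exp_le_exp.2 (mul_le_mul (le_max_right _ _) (Nat.floor_le ht.le)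
          (Nat.cast_nonneg _) (lt_max_of_lt_left (by positivity)).le)
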